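/- Let $n,K\ge 1$ be integers, let $\mathcal C$ be a nonempty finite class of $N$ distinct subsets of $\{1,\dots,n\}$, each of cardinality $K$, and let $\mu>0$. Let $\mathbb P_0$ (with expectation $\mathbb E_0$) be the law under which the components of $X=(X_1,\dots,X_n)$ are independent standard normal random variables, with density $\phi_0(x)=(2\pi)^{-n/2}e^{-\sum_{i=1}^n x_i^2/2}$, and for $S\in\mathcal C$ let $\phi_S(x)=(2\pi)^{-n/2}e^{-\sum_{i\in S}(x_i-\mu)^2/2-\sum_{i\notin S}x_i^2/2}$. Put $X_S=\sum_{i\in S}X_i$, and let $f^*$ be the optimal (likelihood ratio) test, $f^*(x)=1$ if $L(x)>1$ and $f^*(x)=0$ otherwise, where $$L(x)=\frac{\frac1N\sum_{S\in\mathcal C}\phi_S(x)}{\phi_0(x)}.$$ Equip $\mathcal C$ with the distance $d(S,T)=\sqrt{\mathbb E_0(X_S-X_T)^2}$, and let $\mathcal A\subset\mathcal C$ be any $\sqrt K/2$-cover of $\mathcal C$, that is, for every $S\in\mathcal C$ there is $T\in\mathcal A$ with $d(S,T)\le\sqrt K/2$. Then, for every $\delta\in(0,1)$, the type I error of $f^*$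 satisfies $$\mathbb P_0\{f^*(X)=1\}\le\delta$$ whenever $$\mu\ge\frac2K\,\mathbb E_0\max_{S\in\mathcal A}X_S+\sqrt{\frac{32\log(2/\delta)}{K}}.$$ -/

import Mathlib

open MeasureTheory ProbabilityTheory

namespace GaussianTesting

noncomputable section

/-- The law of the observation under the null hypothesis: `n` independent standard normal
components. -/
def nullMeasure (n : ℕ) : Measure (Fin n → ℝ) :=
  Measure.pi fun _ => gaussianReal 0 1

/-- `x_S`, the sum of the coordinates of `x` with index in `S`. -/
def setSum {n : ℕ} (S : Finset (Fin n)) (x : Fin n → ℝ) : ℝ :=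
  ∑ i ∈ S, x i

/-- The density of the observation under the null hypothesis. -/
def nullDensity (n : ℕ) (x : Fin n → ℝ) : ℝ :=
  (2 * Real.pi) ^ (-(n : ℝ) / 2) * Real.exp (-∑ i, x i ^ 2 / 2)

/-- The density of the observation under the alternative in which exactly the components with
index in `S` have mean `μ`. -/
def altDensity {n : ℕ} (μ : ℝ) (S : Finset (Fin n)) (x : Fin n → ℝ) : ℝ :=
  (2 * Real.pi) ^ (-(n : ℝ) / 2) *
    Real.exp (-∑ i ∈ S, (x i - μ) ^ 2 / 2 - ∑ i ∈ Sᶜ, x i ^ 2 / 2)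

/-- The likelihood ratio of the uniform mixture of the alternatives over the class `C` against
the null hypothesis. -/
def likelihoodRatio {n : ℕ} (C : Finset (Finset (Fin n))) (μ : ℝ) (x : Fin n → ℝ) : ℝ :=
  (1 / (C.card : ℝ) * ∑ S ∈ C, altDensity μ S x) / nullDensity n x

/-- The optimal test: reject (value `1`) if and only if the likelihood ratio exceeds `1`. -/
def optimalTest {n : ℕ} (C : Finset (Finset (Fin n))) (μ : ℝ) (x : Fin n → ℝ) : Fin 2 :=
  if 1 < likelihoodRatio C μ x then 1 else 0

/-- The canonical distance `d(S, T) = √(𝔼₀ (X_S - X_T)²)` (the square root of the Hamming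
distance). -/
def canonicalDist {n : ℕ} (S T : Finset (Fin n)) : ℝ :=
  Real.sqrt (∫ x, (setSum S x - setSum T x) ^ 2 ∂(nullMeasure n))

/-- `A` is a `t`-cover of `C`: a subclass such that each member of `C` is within canonical
distance `t` of some member of `A`. -/
def IsCover {n : ℕ} (t : ℝ) (C A : Finset (Finset (Fin n))) : Prop :=
  A ⊆ C ∧ ∀ S ∈ C, ∃ T ∈ A, canonicalDist S T ≤ t

theorem IsCover.nonempty {n : ℕ} {t : ℝ} {C A : Finset (Finset (Fin n))}
    (h : IsCover t C A) (hC : C.Nonempty) : A.Nonempty := by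
  obtain ⟨S, hS⟩ := hC
  obtain ⟨T, hT, -⟩ := h.2 S hS
  exact ⟨T, hT⟩

/-- The expected maximum `𝔼₀ max_{S ∈ A} X_S`. -/
def expectedMax {n : ℕ} (A : Finset (Finset (Fin n))) (hA : A.Nonempty) : ℝ :=
  ∫ x, A.sup' hA (fun S => setSum S x) ∂(nullMeasure n)

end

end GaussianTesting

/-!
Let `M = max_{T ∈ A} X_T` and `B = {M < μ K / 2}`. By Markov's inequality for `L 1_B`, the type I
error is at most `ℙ₀ Bᶜ + 𝔼₀[L; B]`.

The functionals `X_T` have variance `K`, so `M` concentrates around its mean. This is seen by a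
discrete form of the Maurey-Pisier rotation argument: for `y` an independent copy of `x`, the pair
`(x, y)` is carried by `m` rotations of angle `π / (2 m)` to `(y, -x)`, each preserving the Gaussian
law. Jensen's inequality therefore bounds `𝔼 exp (t (M x - M y))` by the exponential moment of `m`
times the increment of `t M` over a single small rotation, which is controlled by the functional
attaining the maximum at `x`. As `m → ∞`, `M - 𝔼₀ M` is seen to be sub-Gaussian with variance proxy
`(π / 2)² K`; since `π ≤ 4`, the constant `32` leaves `ℙ₀ Bᶜ ≤ δ / 2`.

On `B`, choose for each `S` some `T ∈ A` with `|S ∩ T| ≥ 3 K / 4`. Under the alternative `S` the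
mean of `X_T` is `μ |S ∩ T|`, so `X_T < μ K / 2` is a deviation of at least `μ K / 4`, and a
Chernoff bound gives `𝔼₀[L; B] ≤ δ / 2`.
-/

namespace GaussianTesting

noncomputable section

open Filter Real
open scoped NNReal ENNReal Topology

theorem exp_sum_le {κ : Type*} {s : Finset κ} (hs : s.Nonempty) (a : κ → ℝ) :
    exp (∑ k ∈ s, a k) ≤ (s.card : ℝ)⁻¹ * ∑ k ∈ s, exp (s.card * a k) := by
  have hcard : (s.card : ℝ) ≠ 0 := by simpa using hs.ne_empty
  have hjensen := convexOn_exp.map_sum_le (t := s) (w := fun _ => (s.card : ℝ)⁻¹)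
    (p := fun k => s.card * a k) (fun _ _ => by positivity) (by simp [hcard])
    (fun _ _ => Set.mem_univ _)
  simpa [hcard, Finset.mul_sum] using hjensen

theorem exp_neg_div_le_inv {c u y : ℝ} (hc : 0 < c) (hy : 0 < y) (h : c * log y ≤ u) :
    exp (-u / c) ≤ y⁻¹ := by
  rwa [← le_log_iff_exp_le (inv_pos.2 hy), log_inv, neg_div, neg_le_neg_iff, le_div_iff₀' hc]

theorem tendsto_natCast_mul_sub_of_hasDerivAt {f : ℝ → ℝ} {f' : ℝ} (hf : HasDerivAt f f' 0)
    (x : ℝ) : Tendsto (fun m : ℕ => (m : ℝ) * (f (x / m) - f 0)) atTop (𝓝 (x * f')) := by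
  have hlim := hf.hasFDerivAt.lim (c := fun m : ℕ => (m : ℝ)) x
    (by simpa using! tendsto_natCast_atTop_atTop)
  simpa [div_eq_inv_mul] using hlim

section Rotation

variable {E : Type*} [NormedAddCommGroup E] [NormedSpace ℝ E]

theorem rotation_comp_rotation (θ φ : ℝ) (p : E × E) :
    ContinuousLinearMap.rotation θ (ContinuousLinearMap.rotation φ p) =
      ContinuousLinearMap.rotation (θ + φ) p := by
  simp only [ContinuousLinearMap.rotation_apply, cos_add, sin_add]
  ext <;> module

theorem sub_eq_sum_range_rotation (g : E → ℝ) {m : ℕ} (hm : m ≠ 0) (p : E × E) :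
    g p.1 - g p.2 = ∑ k ∈ Finset.range m,
      (g (ContinuousLinearMap.rotation (k * (π / 2 / m)) p).1 -
        g (ContinuousLinearMap.rotation (π / 2 / m)
          (ContinuousLinearMap.rotation (k * (π / 2 / m)) p)).1) := by
  have hend : (m : ℝ) * (π / 2 / m) = π / 2 := by field_simp
  have htel := Finset.sum_range_sub'
    (fun k : ℕ => g (ContinuousLinearMap.rotation (k * (π / 2 / m)) p).1) m
  simp only [hend, ContinuousLinearMap.rotation_apply, Nat.cast_zero, zero_mul, cos_zero, sin_zero,
    cos_pi_div_two, sin_pi_div_two, one_smul, zero_smul, add_zero, zero_add] at htel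
  rw [← htel]
  refine Finset.sum_congr rfl fun k _ => ?_
  rw [rotation_comp_rotation]
  simp only [ContinuousLinearMap.rotation_apply]
  push_cast
  ring_nf

theorem lintegral_exp_sub_le_of_map_rotation [MeasurableSpace E] [BorelSpace E]
    [SecondCountableTopology E] {P : Measure E}
    (hP : ∀ θ, (P.prod P).map (ContinuousLinearMap.rotation θ) = P.prod P)
    {g : E → ℝ} (hg : Measurable g) {m : ℕ} (hm : m ≠ 0) :
    ∫⁻ p, ENNReal.ofReal (exp (g p.1 - g p.2)) ∂(P.prod P) ≤
      ∫⁻ p, ENNReal.ofReal (exp (m *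
        (g p.1 - g (ContinuousLinearMap.rotation (π / 2 / m) p).1))) ∂(P.prod P) := by
  have hrot (θ : ℝ) : MeasurePreserving (ContinuousLinearMap.rotation (E := E) θ)
      (P.prod P) (P.prod P) := ⟨by fun_prop, hP θ⟩
  set w : E × E → ℝ := fun p =>
    exp (m * (g p.1 - g (ContinuousLinearMap.rotation (π / 2 / m) p).1)) with hw
  have hw_meas : Measurable fun p => ENNReal.ofReal (w p) := by fun_prop
  have hpoint (p : E × E) : exp (g p.1 - g p.2) ≤
      (m : ℝ)⁻¹ * ∑ k ∈ Finset.range m, w (ContinuousLinearMap.rotation (k * (π / 2 / m)) p) := by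
    rw [sub_eq_sum_range_rotation g hm p]
    refine (exp_sum_le (Finset.nonempty_range_iff.2 hm) _).trans_eq ?_
    simp only [Finset.card_range, hw]
  calc ∫⁻ p, ENNReal.ofReal (exp (g p.1 - g p.2)) ∂(P.prod P)
      ≤ ∫⁻ p, ENNReal.ofReal (m : ℝ)⁻¹ * ∑ k ∈ Finset.range m,
          ENNReal.ofReal (w (ContinuousLinearMap.rotation (k * (π / 2 / m)) p)) ∂(P.prod P) := by
        refine lintegral_mono fun p => (ENNReal.ofReal_le_ofReal (hpoint p)).trans_eq ?_
        rw [ENNReal.ofReal_mul (by positivity),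
          ENNReal.ofReal_sum_of_nonneg fun _ _ => (exp_pos _).le]
    _ = ENNReal.ofReal (m : ℝ)⁻¹ *
          ∑ _k ∈ Finset.range m, ∫⁻ p, ENNReal.ofReal (w p) ∂(P.prod P) := by
        rw [lintegral_const_mul' _ _ ENNReal.ofReal_ne_top,
          lintegral_finsetSum _ (by fun_prop)]
        congr 1
        exact Finset.sum_congr rfl fun k _ => (hrot _).lintegral_comp hw_meas
    _ = ∫⁻ p, ENNReal.ofReal (w p) ∂(P.prod P) := by
        rw [Finset.sum_const, Finset.card_range, nsmul_eq_mul, ← mul_assoc,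
          ← ENNReal.ofReal_natCast, ← ENNReal.ofReal_mul (by positivity),
          inv_mul_cancel₀ (by positivity), ENNReal.ofReal_one, one_mul]

end Rotation

theorem integrable_of_forall_integrable_exp_mul {Ω : Type*} [MeasurableSpace Ω] {P : Measure Ω}
    {X : Ω → ℝ} (hint : ∀ t, Integrable (fun ω => exp (t * X ω)) P) : Integrable X P :=
  integrable_of_mem_interior_integrableExpSet (by simp [integrableExpSet, hint])

theorem hasSubgaussianMGF_sub_integral_of_mgf_mul_mgf_neg_le {Ω : Type*} [MeasurableSpace Ω]
    {P : Measure Ω} [IsProbabilityMeasure P] {X : Ω → ℝ} {c : ℝ≥0}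
    (hint : ∀ t, Integrable (fun ω => exp (t * X ω)) P)
    (hmgf : ∀ t, mgf X P t * mgf X P (-t) ≤ exp (c * t ^ 2 / 2)) :
    HasSubgaussianMGF (fun ω => X ω - P[X]) c P where
  integrable_exp_mul t := by
    simpa [mul_sub, exp_sub] using (hint t).div_const (exp (t * P[X]))
  mgf_le t := by
    have hjensen : exp (-t * P[X]) ≤ mgf X P (-t) := by
      rw [← integral_const_mul]
      exact convexOn_exp.map_integral_le continuous_exp.continuousOn isClosed_univ (by simp)
        ((integrable_of_forall_integrable_exp_mul hint).const_mul _) (hint _)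
    calc mgf (fun ω => X ω - P[X]) P t = mgf X P t * exp (-t * P[X]) := by
          simpa [sub_eq_add_neg] using mgf_add_const (X := X) (μ := P) (t := t) (-P[X])
      _ ≤ mgf X P t * mgf X P (-t) := by gcongr; exact mgf_nonneg
      _ ≤ exp (c * t ^ 2 / 2) := hmgf t

theorem measureReal_one_lt_le {Ω : Type*} [MeasurableSpace Ω] {P : Measure Ω} [IsFiniteMeasure P]
    {f : Ω → ℝ} (hf0 : 0 ≤ f) (hf : Integrable f P) {B : Set Ω} (hB : MeasurableSet B) :
    P.real {ω | 1 < f ω} ≤ P.real Bᶜ + ∫ ω in B, f ω ∂P := by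
  have hsub : {ω | 1 < f ω} ⊆ Bᶜ ∪ {ω | 1 ≤ f ω} ∩ B := fun ω (hω : 1 < f ω) =>
    (em' (ω ∈ B)).imp_right fun h => ⟨hω.le, h⟩
  have hmarkov := mul_meas_ge_le_integral_of_nonneg (μ := P.restrict B)
    (.of_forall hf0) hf.integrableOn 1
  rw [one_mul, measureReal_restrict_apply' hB] at hmarkov
  calc P.real {ω | 1 < f ω} ≤ P.real (Bᶜ ∪ {ω | 1 ≤ f ω} ∩ B) := measureReal_mono hsub
    _ ≤ P.real Bᶜ + P.real ({ω | 1 ≤ f ω} ∩ B) := measureReal_union_le _ _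
    _ ≤ P.real Bᶜ + ∫ ω in B, f ω ∂P := by gcongr

section Functional

variable {E : Type*} [NormedAddCommGroup E] [NormedSpace ℝ E] [CompleteSpace E]
  [SecondCountableTopology E] [MeasurableSpace E] [BorelSpace E] {P : Measure E} [IsGaussian P]

theorem mgf_strongDual (hP : ∫ x, x ∂P = 0) (L : StrongDual ℝ E) (t : ℝ) :
    mgf L P t = exp (t ^ 2 * Var[L; P] / 2) := by
  have hmean : ∫ x, L x ∂P = 0 := by rw [IsGaussian.integral_dual, hP, map_zero]
  rw [mgf_gaussianReal (IsGaussian.map_eq_gaussianReal L), hmean,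
    coe_toNNReal _ (variance_nonneg _ _)]
  ring_nf

theorem integrable_exp_strongDual (hP : ∫ x, x ∂P = 0) (L : StrongDual ℝ E) (t : ℝ) :
    Integrable (fun x => exp (t * L x)) P :=
  mgf_pos_iff.1 (by rw [mgf_strongDual hP]; positivity)

theorem integrable_exp_strongDual_sub (hP : ∫ x, x ∂P = 0) (L : StrongDual ℝ E) (b : ℝ) :
    Integrable (fun x => exp (L x - b)) P := by
  simpa [exp_sub] using (integrable_exp_strongDual hP L 1).div_const (exp b)

theorem integral_exp_strongDual (hP : ∫ x, x ∂P = 0) (L : StrongDual ℝ E) :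
    ∫ x, exp (L x) ∂P = exp (Var[L; P] / 2) := by
  simpa [mgf] using mgf_strongDual hP L 1

theorem setIntegral_exp_halfSpace_le (hP : ∫ x, x ∂P = 0) (L M : StrongDual ℝ E) {a : ℝ}
    (ha : a ≤ cov[L, M; P]) :
    ∫ x in {x | M x ≤ a}, exp (L x - Var[L; P] / 2) ∂P ≤
      exp (-(cov[L, M; P] - a) ^ 2 / (2 * Var[M; P])) := by
  -- The optimal Chernoff tilt; if `Var[M; P] = 0` then `t = 0` and the bound reads `≤ 1`.
  set t : ℝ := (cov[L, M; P] - a) / Var[M; P] with ht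
  have ht0 : 0 ≤ t := div_nonneg (sub_nonneg.2 ha) (variance_nonneg _ _)
  have hvar : Var[L - t • M; P] = Var[L; P] - 2 * t * cov[L, M; P] + t ^ 2 * Var[M; P] := by
    rw [FunLike.coe_sub, FunLike.coe_smul, variance_sub (IsGaussian.memLp_dual P L 2 (by simp))
      ((IsGaussian.memLp_dual P M 2 (by simp)).const_smul t), covariance_smul_right, variance_smul]
    ring
  have hint : Integrable (fun x => exp (t * a - Var[L; P] / 2) * exp ((L - t • M) x)) P := by
    simpa using (integrable_exp_strongDual hP (L - t • M) 1).const_mul _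
  calc ∫ x in {x | M x ≤ a}, exp (L x - Var[L; P] / 2) ∂P
      ≤ ∫ x in {x | M x ≤ a}, exp (t * a - Var[L; P] / 2) * exp ((L - t • M) x) ∂P := by
        refine setIntegral_mono_on (integrable_exp_strongDual_sub hP L _).integrableOn
          hint.integrableOn (measurableSet_le (by fun_prop) (by fun_prop)) fun x hx => ?_
        have htilt : t * M x ≤ t * a := mul_le_mul_of_nonneg_left hx ht0
        rw [← exp_add, exp_le_exp, sub_apply, smul_apply, smul_eq_mul]
        linarith
    _ ≤ ∫ x, exp (t * a - Var[L; P] / 2) * exp ((L - t • M) x) ∂P :=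
        setIntegral_le_integral hint (.of_forall fun _ => by positivity)
    _ = exp (t ^ 2 * Var[M; P] / 2 - t * (cov[L, M; P] - a)) := by
        rw [integral_const_mul, integral_exp_strongDual hP, hvar, ← exp_add]
        ring_nf
    _ = exp (-(cov[L, M; P] - a) ^ 2 / (2 * Var[M; P])) := by
        rcases eq_or_ne Var[M; P] 0 with h0 | h0
        · simp [ht, h0]
        · rw [ht]; congr 1; field_simp; ring

end Functional

/-- The maximum `max_{i ∈ s} L i` of finitely many continuous linear functionals, as a function on
the underlying space. -/
def dualMax {ι E : Type*} [NormedAddCommGroup E] [NormedSpace ℝ E] (L : ι → StrongDual ℝ E)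
    {s : Finset ι} (hs : s.Nonempty) (x : E) : ℝ :=
  s.sup' hs fun i => L i x

section Maximum

variable {E ι : Type*} [NormedAddCommGroup E] [NormedSpace ℝ E] [MeasurableSpace E] [BorelSpace E]
  (L : ι → StrongDual ℝ E) {s : Finset ι} (hs : s.Nonempty)

@[fun_prop]
theorem measurable_dualMax : Measurable (dualMax L hs) := by
  have hfun : dualMax L hs = s.sup' hs fun i => ⇑(L i) := by
    ext x
    rw [dualMax, Finset.sup'_apply]
  exact hfun ▸ Finset.measurable_sup' hs fun i _ => (L i).measurable

variable [CompleteSpace E] [SecondCountableTopology E] {P : Measure E} [IsGaussian P]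

theorem integrable_exp_dualMax (hP : ∫ x, x ∂P = 0) (t : ℝ) :
    Integrable (fun x => exp (t * dualMax L hs x)) P := by
  refine (integrable_finsetSum s fun i _ => integrable_exp_strongDual hP (L i) t).mono'
    (by fun_prop) (.of_forall fun x => ?_)
  obtain ⟨i, hi, hmax⟩ := Finset.exists_mem_eq_sup' hs fun i => L i x
  rw [dualMax, hmax, norm_of_nonneg (exp_pos _).le]
  exact Finset.single_le_sum (f := fun i => exp (t * L i x)) (fun _ _ => (exp_pos _).le) hi

theorem lintegral_exp_dualMax_sub_le (hP : ∫ x, x ∂P = 0) {v : ℝ} (hv : ∀ i ∈ s, Var[L i; P] ≤ v)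
    {c : ℝ} (hc : 0 ≤ c) (a b : ℝ) (x : E) :
    ∫⁻ y, ENNReal.ofReal (exp (c * (dualMax L hs x - dualMax L hs (a • x + b • y)))) ∂P ≤
      ENNReal.ofReal (exp (c * (1 - a) * dualMax L hs x) * exp ((c * b) ^ 2 * v / 2)) := by
  obtain ⟨i, hi, hmax⟩ : ∃ i ∈ s, dualMax L hs x = L i x := Finset.exists_mem_eq_sup' hs _
  have hpoint (y : E) : exp (c * (dualMax L hs x - dualMax L hs (a • x + b • y))) ≤
      exp (c * (1 - a) * dualMax L hs x) * exp (-(c * b) * L i y) := by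
    have hle : L i (a • x + b • y) ≤ dualMax L hs (a • x + b • y) :=
      Finset.le_sup' (fun i => L i (a • x + b • y)) hi
    rw [map_add, map_smul, map_smul, smul_eq_mul, smul_eq_mul] at hle
    rw [← exp_add, exp_le_exp, hmax]
    linarith [mul_le_mul_of_nonneg_left hle hc]
  calc _ ≤ ∫⁻ y, ENNReal.ofReal (exp (c * (1 - a) * dualMax L hs x) * exp (-(c * b) * L i y)) ∂P :=
        lintegral_mono fun y => ENNReal.ofReal_le_ofReal (hpoint y)
    _ = ENNReal.ofReal (exp (c * (1 - a) * dualMax L hs x) * mgf (L i) P (-(c * b))) := by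
        rw [← ofReal_integral_eq_lintegral_ofReal
          ((integrable_exp_strongDual hP (L i) _).const_mul _) (.of_forall fun _ => by positivity),
          integral_const_mul, mgf]
    _ ≤ _ := by
        rw [mgf_strongDual hP, neg_sq]
        gcongr
        exact hv i hi

theorem lintegral_exp_dualMax_sub_rotation_le (hP : ∫ x, x ∂P = 0) {v : ℝ}
    (hv : ∀ i ∈ s, Var[L i; P] ≤ v) {c : ℝ} (hc : 0 ≤ c) (θ : ℝ) :
    ∫⁻ p, ENNReal.ofReal (exp (c *
        (dualMax L hs p.1 - dualMax L hs (ContinuousLinearMap.rotation θ p).1))) ∂(P.prod P) ≤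
      ENNReal.ofReal
        (mgf (dualMax L hs) P (c * (1 - cos θ)) * exp ((c * sin θ) ^ 2 * v / 2)) := by
  rw [lintegral_prod _ (by fun_prop), mgf, ← integral_mul_const,
    ofReal_integral_eq_lintegral_ofReal
      ((integrable_exp_dualMax L hs hP _).mul_const _) (.of_forall fun _ => by positivity)]
  exact lintegral_mono fun x => lintegral_exp_dualMax_sub_le L hs hP hv hc (cos θ) (sin θ) x

theorem mgf_dualMax_mul_mgf_neg_le_of_rotation (hP : ∫ x, x ∂P = 0) {v : ℝ}
    (hv : ∀ i ∈ s, Var[L i; P] ≤ v) {t : ℝ} (ht : 0 ≤ t) {m : ℕ} (hm : m ≠ 0) :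
    mgf (dualMax L hs) P t * mgf (dualMax L hs) P (-t) ≤
      mgf (dualMax L hs) P (t * m * (1 - cos (π / 2 / m))) *
        exp ((t * m * sin (π / 2 / m)) ^ 2 * v / 2) := by
  have hint := integrable_exp_dualMax L hs hP
  rw [← ENNReal.ofReal_le_ofReal_iff (mul_nonneg mgf_nonneg (exp_pos _).le)]
  calc ENNReal.ofReal (mgf (dualMax L hs) P t * mgf (dualMax L hs) P (-t))
      = ∫⁻ p, ENNReal.ofReal (exp (t * dualMax L hs p.1 - t * dualMax L hs p.2)) ∂(P.prod P) := by
        rw [mgf, mgf, ← integral_prod_mul, ofReal_integral_eq_lintegral_ofReal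
          ((hint t).mul_prod (hint (-t))) (.of_forall fun _ => by positivity)]
        simp only [← exp_add, neg_mul, sub_eq_add_neg]
    _ ≤ ∫⁻ p, ENNReal.ofReal (exp (t * m * (dualMax L hs p.1 -
          dualMax L hs (ContinuousLinearMap.rotation (π / 2 / m) p).1))) ∂(P.prod P) := by
        simpa only [← mul_sub, ← mul_assoc, mul_comm (m : ℝ) t] using
          lintegral_exp_sub_le_of_map_rotation (P := P)
            (fun θ => IsGaussian.map_rotation_eq_self (by simpa using hP) θ)
            ((measurable_dualMax L hs).const_mul t) hm
    _ ≤ _ := lintegral_exp_dualMax_sub_rotation_le L hs hP hv (by positivity) _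

theorem mgf_dualMax_mul_mgf_neg_le (hP : ∫ x, x ∂P = 0) {v : ℝ}
    (hv : ∀ i ∈ s, Var[L i; P] ≤ v) {t : ℝ} (ht : 0 ≤ t) :
    mgf (dualMax L hs) P t * mgf (dualMax L hs) P (-t) ≤ exp ((π / 2) ^ 2 * v * t ^ 2 / 2) := by
  have hsin : Tendsto (fun m : ℕ => t * m * sin (π / 2 / m)) atTop (𝓝 (t * (π / 2))) := by
    simpa [mul_assoc] using
      (tendsto_natCast_mul_sub_of_hasDerivAt (hasDerivAt_sin 0) (π / 2)).const_mul t
  have hcos : Tendsto (fun m : ℕ => t * m * (1 - cos (π / 2 / m))) atTop (𝓝 0) := by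
    simpa [mul_assoc, mul_sub, neg_add_eq_sub] using
      (tendsto_natCast_mul_sub_of_hasDerivAt (hasDerivAt_cos 0) (π / 2)).const_mul (-t)
  have hmgf : Tendsto (fun m : ℕ => mgf (dualMax L hs) P (t * m * (1 - cos (π / 2 / m)))) atTop
      (𝓝 1) := by
    simpa [Function.comp_def] using
      ((continuous_mgf (integrable_exp_dualMax L hs hP)).tendsto 0).comp hcos
  have hlim := hmgf.mul ((((hsin.pow 2).mul_const v).div_const 2).rexp)
  have heq : 1 * exp ((t * (π / 2)) ^ 2 * v / 2) = exp ((π / 2) ^ 2 * v * t ^ 2 / 2) := by ring_nf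
  rw [← heq]
  refine ge_of_tendsto hlim ?_
  filter_upwards [eventually_ne_atTop 0] with m hm
  exact mgf_dualMax_mul_mgf_neg_le_of_rotation L hs hP hv ht hm

theorem hasSubgaussianMGF_dualMax_sub_mean (hP : ∫ x, x ∂P = 0) {v : ℝ≥0}
    (hv : ∀ i ∈ s, Var[L i; P] ≤ v) :
    HasSubgaussianMGF (fun x => dualMax L hs x - ∫ y, dualMax L hs y ∂P)
      ((NNReal.pi / 2) ^ 2 * v) P := by
  refine hasSubgaussianMGF_sub_integral_of_mgf_mul_mgf_neg_le
    (integrable_exp_dualMax L hs hP) fun t => ?_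
  rcases le_total 0 t with ht | ht
  · simpa using mgf_dualMax_mul_mgf_neg_le L hs hP hv ht
  · simpa [mul_comm] using mgf_dualMax_mul_mgf_neg_le L hs hP hv (neg_nonneg.2 ht)

theorem measureReal_dualMax_ge_le (hP : ∫ x, x ∂P = 0) {v : ℝ≥0}
    (hv : ∀ i ∈ s, Var[L i; P] ≤ v) {a : ℝ} (ha : ∫ x, dualMax L hs x ∂P ≤ a) :
    P.real {x | a ≤ dualMax L hs x} ≤
      exp (-(a - ∫ x, dualMax L hs x ∂P) ^ 2 / (2 * ((π / 2) ^ 2 * v))) := by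
  simpa using (hasSubgaussianMGF_dualMax_sub_mean L hs hP hv).measure_ge_le (sub_nonneg.2 ha)

theorem integral_dualMax_nonneg (hP : ∫ x, x ∂P = 0) : 0 ≤ ∫ x, dualMax L hs x ∂P := by
  obtain ⟨i, hi⟩ := hs
  rw [← map_zero (L i), ← hP, ← IsGaussian.integral_dual]
  exact integral_mono (IsGaussian.integrable_dual P (L i))
    (integrable_of_forall_integrable_exp_mul (integrable_exp_dualMax L _ hP))
    fun x => Finset.le_sup' (fun i => L i x) hi

end Maximum

section NullMeasure

variable {n : ℕ}

theorem hasLaw_eval_nullMeasure (i : Fin n) :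
    HasLaw (fun x => x i) (gaussianReal 0 1) (nullMeasure n) :=
  (measurePreserving_eval (fun _ => gaussianReal 0 1) i).hasLaw

theorem iIndepFun_eval_nullMeasure (n : ℕ) :
    iIndepFun (fun (i : Fin n) (x : Fin n → ℝ) => x i) (nullMeasure n) :=
  iIndepFun_pi (X := fun _ => id) fun _ => aemeasurable_id

instance isGaussian_nullMeasure (n : ℕ) : IsGaussian (nullMeasure n) := by
  simpa using! ((iIndepFun_eval_nullMeasure n).hasGaussianLaw fun i =>
    (hasLaw_eval_nullMeasure i).hasGaussianLaw).isGaussian_map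

theorem integral_id_nullMeasure (n : ℕ) : ∫ x, x ∂(nullMeasure n) = 0 := by
  ext i
  have hproj := IsGaussian.integral_dual (μ := nullMeasure n) (ContinuousLinearMap.proj (R := ℝ) i)
  simp only [ContinuousLinearMap.proj_apply] at hproj
  rw [← hproj, (hasLaw_eval_nullMeasure i).integral_eq, integral_id_gaussianReal, Pi.zero_apply]

theorem memLp_two_eval_nullMeasure (i : Fin n) :
    MemLp (fun x : Fin n → ℝ => x i) 2 (nullMeasure n) :=
  IsGaussian.memLp_dual (nullMeasure n) (ContinuousLinearMap.proj (R := ℝ) i) 2 (by simp)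

theorem covariance_eval_nullMeasure (i j : Fin n) :
    cov[fun x => x i, fun x => x j; nullMeasure n] = if i = j then 1 else 0 := by
  split_ifs with hij
  · rw [hij, covariance_self (measurable_pi_apply j).aemeasurable,
      (hasLaw_eval_nullMeasure j).variance_eq, variance_id_gaussianReal, NNReal.coe_one]
  · exact ((iIndepFun_eval_nullMeasure n).indepFun hij).covariance_eq_zero
      (memLp_two_eval_nullMeasure i) (memLp_two_eval_nullMeasure j)

/-- The statistic `X_S` as a continuous linear functional of the observation. -/
def setSumCLM (S : Finset (Fin n)) : StrongDual ℝ (Fin n → ℝ) :=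
  ∑ i ∈ S, ContinuousLinearMap.proj i

@[simp]
theorem setSumCLM_apply (S : Finset (Fin n)) (x : Fin n → ℝ) : setSumCLM S x = setSum S x := by
  simp [setSumCLM, setSum]

theorem covariance_setSumCLM (S T : Finset (Fin n)) :
    cov[setSumCLM S, setSumCLM T; nullMeasure n] = (S ∩ T).card := by
  have hcoe (S : Finset (Fin n)) : (setSumCLM S : (Fin n → ℝ) → ℝ) = fun x => ∑ i ∈ S, x i := by
    ext x; simp [setSum]
  rw [hcoe, hcoe, covariance_fun_sum_fun_sum' (fun i _ => memLp_two_eval_nullMeasure i)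
    fun i _ => memLp_two_eval_nullMeasure i]
  simp [covariance_eval_nullMeasure, Finset.sum_ite_mem]

theorem variance_setSumCLM (S : Finset (Fin n)) : Var[setSumCLM S; nullMeasure n] = S.card := by
  rw [← covariance_self (setSumCLM S).measurable.aemeasurable, covariance_setSumCLM,
    Finset.inter_self]

theorem canonicalDist_sq (S T : Finset (Fin n)) :
    canonicalDist S T ^ 2 = S.card + T.card - 2 * (S ∩ T).card := by
  have hL2 (S : Finset (Fin n)) := IsGaussian.memLp_dual (nullMeasure n) (setSumCLM S) 2 (by simp)
  have hmean : ∫ x, (setSumCLM S - setSumCLM T) x ∂(nullMeasure n) = 0 := by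
    rw [IsGaussian.integral_dual, integral_id_nullMeasure, map_zero]
  calc canonicalDist S T ^ 2
      = ∫ x, (setSumCLM S - setSumCLM T) x ^ 2 ∂(nullMeasure n) := by
        rw [canonicalDist, sq_sqrt (integral_nonneg fun x => sq_nonneg _)]
        simp only [sub_apply, setSumCLM_apply]
    _ = Var[setSumCLM S - setSumCLM T; nullMeasure n] :=
        (variance_of_integral_eq_zero (by fun_prop) hmean).symm
    _ = S.card + T.card - 2 * (S ∩ T).card := by
        rw [FunLike.coe_sub, variance_sub (hL2 S) (hL2 T), variance_setSumCLM, variance_setSumCLM,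
          covariance_setSumCLM]
        ring

theorem expectedMax_eq_integral_dualMax {A : Finset (Finset (Fin n))} (hA : A.Nonempty) :
    expectedMax A hA = ∫ x, dualMax setSumCLM hA x ∂(nullMeasure n) := by
  simp only [expectedMax, dualMax, setSumCLM_apply]

theorem expectedMax_nonneg {A : Finset (Finset (Fin n))} (hA : A.Nonempty) :
    0 ≤ expectedMax A hA :=
  expectedMax_eq_integral_dualMax hA ▸
    integral_dualMax_nonneg setSumCLM hA (integral_id_nullMeasure n)

end NullMeasure

section LikelihoodRatio

variable {n : ℕ}

theorem altDensity_div_nullDensity (μ : ℝ) (S : Finset (Fin n)) (x : Fin n → ℝ) :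
    altDensity μ S x / nullDensity n x =
      exp ((μ • setSumCLM S) x - Var[μ • setSumCLM S; nullMeasure n] / 2) := by
  have hvar : Var[μ • setSumCLM S; nullMeasure n] = ∑ i ∈ S, μ ^ 2 := by
    rw [FunLike.coe_smul, variance_smul, variance_setSumCLM, Finset.sum_const, nsmul_eq_mul,
      mul_comm]
  rw [altDensity, nullDensity, mul_div_mul_left _ _ (by positivity), ← exp_sub, hvar, smul_apply,
    setSumCLM_apply, ← Finset.sum_add_sum_compl S fun i => x i ^ 2 / 2, setSum, smul_eq_mul,
    Finset.mul_sum, Finset.sum_div]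
  congr 1
  have hsquare : ∑ i ∈ S, (x i - μ) ^ 2 / 2 =
      ∑ i ∈ S, x i ^ 2 / 2 - ∑ i ∈ S, μ * x i + ∑ i ∈ S, μ ^ 2 / 2 := by
    rw [← Finset.sum_sub_distrib, ← Finset.sum_add_distrib]
    exact Finset.sum_congr rfl fun i _ => by ring
  linarith

theorem likelihoodRatio_eq (C : Finset (Finset (Fin n))) (μ : ℝ) (x : Fin n → ℝ) :
    likelihoodRatio C μ x = (C.card : ℝ)⁻¹ * ∑ S ∈ C,
      exp ((μ • setSumCLM S) x - Var[μ • setSumCLM S; nullMeasure n] / 2) := by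
  simp only [likelihoodRatio, mul_div_assoc, Finset.sum_div, altDensity_div_nullDensity, one_div]

theorem likelihoodRatio_nonneg (C : Finset (Finset (Fin n))) (μ : ℝ) (x : Fin n → ℝ) :
    0 ≤ likelihoodRatio C μ x := by
  rw [likelihoodRatio_eq]; positivity

theorem integrable_likelihoodRatio (C : Finset (Finset (Fin n))) (μ : ℝ) :
    Integrable (likelihoodRatio C μ) (nullMeasure n) := by
  simp only [funext (likelihoodRatio_eq C μ)]
  exact (integrable_finsetSum C fun S _ =>
    integrable_exp_strongDual_sub (integral_id_nullMeasure n) (μ • setSumCLM S) _).const_mul _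

theorem setIntegral_likelihoodRatio_le {C : Finset (Finset (Fin n))} (hC : C.Nonempty) {μ ε : ℝ}
    {B : Set (Fin n → ℝ)}
    (hε : ∀ S ∈ C, ∫ x in B, exp ((μ • setSumCLM S) x -
      Var[μ • setSumCLM S; nullMeasure n] / 2) ∂(nullMeasure n) ≤ ε) :
    ∫ x in B, likelihoodRatio C μ x ∂(nullMeasure n) ≤ ε := by
  simp only [likelihoodRatio_eq]
  rw [integral_const_mul, integral_finsetSum _ fun S _ =>
    (integrable_exp_strongDual_sub (integral_id_nullMeasure n) (μ • setSumCLM S) _).integrableOn,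
    inv_mul_le_iff₀ (by simpa using hC.card_pos)]
  simpa using Finset.sum_le_card_nsmul C _ ε hε

theorem setIntegral_likelihoodRatio_dualMax_lt_le {C A : Finset (Finset (Fin n))} (hC : C.Nonempty)
    (hA : A.Nonempty) {K : ℕ} (hcard : ∀ T ∈ A, T.card = K) {q : ℝ}
    (hq : ∀ S ∈ C, ∃ T ∈ A, q ≤ (S ∩ T).card) {μ a : ℝ} (hμ : 0 ≤ μ) (ha : a ≤ μ * q) :
    ∫ x in {x | dualMax setSumCLM hA x < a}, likelihoodRatio C μ x ∂(nullMeasure n) ≤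
      exp (-(μ * q - a) ^ 2 / (2 * K)) := by
  refine setIntegral_likelihoodRatio_le hC fun S hS => ?_
  obtain ⟨T, hT, hqT⟩ := hq S hS
  have hcov : cov[μ • setSumCLM S, setSumCLM T; nullMeasure n] = μ * (S ∩ T).card := by
    rw [FunLike.coe_smul, covariance_smul_left, covariance_setSumCLM]
  have hle : μ * q ≤ μ * (S ∩ T).card := mul_le_mul_of_nonneg_left hqT hμ
  have hhalf := setIntegral_exp_halfSpace_le (integral_id_nullMeasure n) (μ • setSumCLM S)
    (setSumCLM T) (hcov.symm ▸ ha.trans hle)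
  rw [hcov, variance_setSumCLM, hcard T hT] at hhalf
  have hsub : {x | dualMax setSumCLM hA x < a} ⊆ {x | setSumCLM T x ≤ a} := fun x (hx : _ < a) =>
    (Finset.le_sup' (fun T => setSumCLM T x) hT).trans hx.le
  calc _ ≤ _ := setIntegral_mono_set
          (integrable_exp_strongDual_sub (integral_id_nullMeasure n) _ _).integrableOn
          (.of_forall fun _ => (exp_pos _).le) hsub.eventuallyLE
    _ ≤ _ := hhalf
    _ ≤ _ := by gcongr

theorem typeIError_le {C A : Finset (Finset (Fin n))} (hC : C.Nonempty) (hA : A.Nonempty) {K : ℕ}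
    (hcard : ∀ T ∈ A, T.card = K) {q : ℝ} (hq : ∀ S ∈ C, ∃ T ∈ A, q ≤ (S ∩ T).card) {μ a : ℝ}
    (hμ : 0 ≤ μ) (hEa : expectedMax A hA ≤ a) (ha : a ≤ μ * q) :
    (nullMeasure n).real {x | optimalTest C μ x = 1} ≤
      exp (-(a - expectedMax A hA) ^ 2 / (2 * ((π / 2) ^ 2 * K))) +
        exp (-(μ * q - a) ^ 2 / (2 * K)) := by
  have hreject : {x | optimalTest C μ x = 1} = {x | 1 < likelihoodRatio C μ x} := by
    simp [optimalTest]
  have hcompl : {x | dualMax setSumCLM hA x < a}ᶜ = {x | a ≤ dualMax setSumCLM hA x} := by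
    ext; simp
  have hvar : ∀ T ∈ A, Var[setSumCLM T; nullMeasure n] ≤ (K : ℝ≥0) := fun T hT => by
    simp [variance_setSumCLM, hcard T hT]
  rw [expectedMax_eq_integral_dualMax] at hEa ⊢
  have htail := measureReal_dualMax_ge_le setSumCLM hA (integral_id_nullMeasure n) hvar hEa
  calc (nullMeasure n).real {x | optimalTest C μ x = 1}
      ≤ (nullMeasure n).real {x | a ≤ dualMax setSumCLM hA x} +
          ∫ x in {x | dualMax setSumCLM hA x < a}, likelihoodRatio C μ x ∂(nullMeasure n) := by
        rw [hreject, ← hcompl]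
        exact measureReal_one_lt_le (likelihoodRatio_nonneg C μ) (integrable_likelihoodRatio C μ)
          (measurableSet_lt (by fun_prop) (by fun_prop))
    _ ≤ _ := add_le_add (by simpa using htail)
        (setIntegral_likelihoodRatio_dualMax_lt_le hC hA hcard hq hμ ha)

theorem typeIError_le_of_three_quarters_le_card_inter {C A : Finset (Finset (Fin n))}
    (hC : C.Nonempty) (hA : A.Nonempty) {K : ℕ} (hK : 0 < K) (hcard : ∀ T ∈ A, T.card = K)
    (hq : ∀ S ∈ C, ∃ T ∈ A, 3 / 4 * (K : ℝ) ≤ (S ∩ T).card) {δ μ : ℝ} (hδ : 0 < δ)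
    (hbound : 2 / (K : ℝ) * expectedMax A hA + √(32 * log (2 / δ) / K) ≤ μ) :
    (nullMeasure n).real {x | optimalTest C μ x = 1} ≤ δ := by
  have hK' : (0 : ℝ) < K := Nat.cast_pos.2 hK
  have hE := expectedMax_nonneg hA
  set r := √(32 * log (2 / δ) / K) with hr
  have hr0 : 0 ≤ r := sqrt_nonneg _
  have hμr : r ≤ μ := (le_add_of_nonneg_left (by positivity)).trans hbound
  have hdev : K * r / 2 ≤ μ * K / 2 - expectedMax A hA := by
    field_simp at hbound
    linarith
  have hgap : K * r / 4 ≤ μ * (3 / 4 * K) - μ * K / 2 := by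
    linarith [mul_le_mul_of_nonneg_left hμr hK'.le]
  have hlog : log (2 / δ) ≤ K * r ^ 2 / 32 := by
    have hsq : 32 * log (2 / δ) / K ≤ r ^ 2 := (sqrt_le_left hr0).1 hr.ge
    rw [div_le_iff₀ hK'] at hsq
    linarith
  have hhalf : δ = (2 / δ)⁻¹ + (2 / δ)⁻¹ := by rw [inv_div, add_halves]
  rw [hhalf]
  refine (typeIError_le (a := μ * K / 2) hC hA hcard hq (hr0.trans hμr) ?_ ?_).trans
    (add_le_add (exp_neg_div_le_inv (by positivity) (by positivity) ?_)
      (exp_neg_div_le_inv (by positivity) (by positivity) ?_))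
  · exact sub_nonneg.1 (le_trans (by positivity) hdev)
  · exact sub_nonneg.1 (le_trans (by positivity) hgap)
  · calc 2 * ((π / 2) ^ 2 * K) * log (2 / δ)
        ≤ 2 * ((π / 2) ^ 2 * K) * (K * r ^ 2 / 32) := by gcongr
      _ ≤ 2 * ((4 / 2) ^ 2 * K) * (K * r ^ 2 / 32) := by gcongr; exact pi_le_four
      _ = (K * r / 2) ^ 2 := by ring
      _ ≤ _ := by gcongr
  · calc 2 * K * log (2 / δ) ≤ 2 * K * (K * r ^ 2 / 32) := by gcongr
      _ = (K * r / 4) ^ 2 := by ring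
      _ ≤ _ := by gcongr

end LikelihoodRatio

section Cover

variable {n : ℕ} {C A : Finset (Finset (Fin n))}

theorem IsCover.mono {t u : ℝ} (hA : IsCover t C A) (htu : t ≤ u) : IsCover u C A :=
  ⟨hA.1, fun S hS => (hA.2 S hS).imp fun _ => And.imp_right (le_trans · htu)⟩

theorem IsCover.exists_le_card_inter {t : ℝ} (hA : IsCover t C A) {K : ℕ}
    (hcard : ∀ S ∈ C, S.card = K) {S : Finset (Fin n)} (hS : S ∈ C) :
    ∃ T ∈ A, K - t ^ 2 / 2 ≤ (S ∩ T).card := by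
  obtain ⟨T, hT, hdist⟩ := hA.2 S hS
  refine ⟨T, hT, ?_⟩
  have hsq := pow_le_pow_left₀ (sqrt_nonneg _) hdist 2
  rw [← canonicalDist, canonicalDist_sq, hcard S hS, hcard T (hA.1 hT)] at hsq
  linarith

end Cover

end

end GaussianTesting

theorem mainTheorem5_general (n K : ℕ) (hK : 0 < K) (C : Finset (Finset (Fin n)))
    (hC : C.Nonempty) (hcard : ∀ S ∈ C, S.card = K) (A : Finset (Finset (Fin n)))
    (hA : GaussianTesting.IsCover (Real.sqrt (K / 2)) C A) (δ : ℝ) (hδ : 0 < δ) (μ : ℝ)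
    (hbound : 2 / (K : ℝ) * GaussianTesting.expectedMax A (hA.nonempty hC)
      + Real.sqrt (32 * Real.log (2 / δ) / (K : ℝ)) ≤ μ) :
    (GaussianTesting.nullMeasure n).real
      {x | GaussianTesting.optimalTest C μ x = 1} ≤ δ := by
  refine GaussianTesting.typeIError_le_of_three_quarters_le_card_inter hC (hA.nonempty hC) hK
    (fun T hT => hcard T (hA.1 hT)) (fun S hS => ?_) hδ hbound
  obtain ⟨T, hT, hle⟩ := hA.exists_le_card_inter hcard hS
  rw [Real.sq_sqrt (by positivity)] at hle
  exact ⟨T, hT, by linarith⟩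

theorem mainTheorem5 (n K : ℕ) (hK : 0 < K) (C : Finset (Finset (Fin n)))
    (hC : C.Nonempty) (hcard : ∀ S ∈ C, S.card = K)
    (A : Finset (Finset (Fin n)))
    (hA : GaussianTesting.IsCover (Real.sqrt (K : ℝ) / 2) C A)
    (δ : ℝ) (hδ0 : 0 < δ) (hδ1 : δ < 1) (μ : ℝ) (hμ : 0 < μ)
    (hbound : 2 / (K : ℝ) * GaussianTesting.expectedMax A (hA.nonempty hC)
      + Real.sqrt (32 * Real.log (2 / δ) / (K : ℝ)) ≤ μ) :
    (GaussianTesting.nullMeasure n).real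
      {x | GaussianTesting.optimalTest C μ x = 1} ≤ δ := by
  have hradius : Real.sqrt K / 2 ≤ Real.sqrt (K / 2) := by
    refine Real.le_sqrt_of_sq_le ?_
    rw [div_pow, Real.sq_sqrt K.cast_nonneg]
    linarith [K.cast_nonneg (α := ℝ)]
  exact mainTheorem5_general n K hK C hC hcard A (hA.mono hradius) δ hδ0 μ hbound
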